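/- Let $Q$ be a finite quiver with vertex set $\{1,\dots,n\}$, possibly with loops, multiple arrows and oriented cycles. Let $\mathbb{C}\langle\langle Q\rangle\rangle=\prod_{m\ge 0}\mathbb{C}Q_m$ be its completed path algebra, where $\mathbb{C}Q_m$ is the vector space with basis the paths of length $m$, and put $\mathfrak m^2=\prod_{m\ge 2}\mathbb{C}Q_m$. Let $\Lambda=\mathbb{C}\langle\langle Q\rangle\rangle/I$, where $I$ is a two-sided ideal with $I\subseteq\mathfrak m^2$. Let $B_Q=(b_{ij})\in M_n(\mathbb{Z})$ be the skew-symmetric matrix $$b_{ij}=|\{\text{arrows } j\to i\}|-|\{\text{arrows } i\to j\}|.$$ A representation of $\Lambda$ is a finite-dimensional nilpotent complex representation $M=(M_i,M_a)$ of $Q$ annihilated by $I$; equivalently, it is a finite-dimensional left $\Lambda$-module. A decorated representation of $\Lambda$ is a pair $\mathcal M=(M,V)$ consisting of a representation $M$ of $\Lambda$ and a tuple $V=(V_1,\dots,V_n)$ of finite-dimensional complex vector spaces. Its $g$-vector $g_\Lambda(\mathcal M)=(g_1,\dots,g_n)\in\mathbb{Z}^n$ is given by $$g_i=-\dim\operatorname{Hom}_\Lambda(S_i,M)+\dim\operatorname{Ext}^1_\Lambda(S_i,M)+\dim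 V_i,$$ where $S_i$ is the one-dimensional simple representation at the vertex $i$. Its Caldero–Chapoton function is the Laurent polynomial $$C_\Lambda(\mathcal M)=\mathbf x^{g_\Lambda(\mathcal M)}\sum_{\mathbf e\in\mathbb{N}^n}\chi(\operatorname{Gr}_{\mathbf e}(M))\,\mathbf x^{B_Q\mathbf e}\in\mathbb{Z}[x_1^{\pm1},\dots,x_n^{\pm1}],$$ where $\mathbf x^{\mathbf a}=x_1^{a_1}\cdots x_n^{a_n}$, $\operatorname{Gr}_{\mathbf e}(M)$ is the quiver Grassmannian of subrepresentations of $M$ with dimension vector $\mathbf e$ (with its classical topology) and $\chi$ is the Euler–Poincaré characteristic. The Caldero–Chapoton algebra $\mathcal A_\Lambda$ is the $\mathbb{C}$-subalgebra of $\mathbb{C}[x_1^{\pm1},\dots,x_n^{\pm1}]$ generated by the functions $C_\Lambda(\mathcal M)$ of all decorated representations $\mathcal M$ of $\Lambda$. **Proposition.** Let $(\mathcal M_j)_{j\in J}$ be a family (with an arbitrary index set $J$) of decorated representations of $\Lambda$. Assume that 1. $\operatorname{Ker}(B_Q)\cap\mathbb{Q}_{\ge 0}^n=\{0\}$, where $B_Q$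 is regarded as a linear map $\mathbb{Q}^n\to\mathbb{Q}^n$ and $\mathbb{Q}_{\ge 0}^n$ is the set of vectors in $\mathbb{Q}^n$ with non-negative entries, and 2. the $g$-vectors $g_\Lambda(\mathcal M_j)$, $j\in J$, are pairwise different. Then the Caldero–Chapoton functions $C_\Lambda(\mathcal M_j)$, $j\in J$, are pairwise different, and they are linearly independent over $\mathbb{C}$ in $\mathcal A_\Lambda$. -/

import Mathlib

/-! ## The completed path algebra of a finite quiver

A finite quiver is a finite type `V` of vertices with finite types `i ⟶ j` of arrows from `i` to `j`.
`Quiver.Path i j` is the type of paths from `i` to `j` (including the trivial path if `i = j`), and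
`q.comp r` is "first `q`, then `r`", so it is the product `r q` in the path algebra. -/

section PathAlgebra

variable {V : Type} [Quiver.{0} V]

/-- All ways to write a path `p` as "first `q`, then `r`", as a list of triples
`(middle vertex, q, r)`. -/
def Quiver.Path.splittings {i : V} : {j : V} → Quiver.Path i j →
    List (Σ k : V, Quiver.Path i k × Quiver.Path k j)
  | _, .nil => [⟨i, .nil, .nil⟩]
  | _, .cons p a =>
      ⟨_, p.cons a, .nil⟩ :: (Quiver.Path.splittings p).map fun s => ⟨s.1, s.2.1, s.2.2.cons a⟩

theorem Quiver.Path.mem_splittings {i j : V} (p : Quiver.Path i j)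
    (s : Σ k : V, Quiver.Path i k × Quiver.Path k j) :
    s ∈ p.splittings ↔ s.2.1.comp s.2.2 = p := by
  induction p with
  | nil =>
    obtain ⟨k, q, r⟩ := s
    cases r with
    | nil => simp [Quiver.Path.splittings]
    | cons r a =>
      simp only [Quiver.Path.splittings, List.mem_singleton, Quiver.Path.comp_cons]
      constructor
      · intro h
        have := congrArg (fun t => t.2.2.length) h
        simp at this
      · intro h
        have := congrArg Quiver.Path.length h
        simp at this
  | cons p a ih =>
    obtain ⟨k, q, r⟩ := s
    simp only [Quiver.Path.splittings, List.mem_cons, List.mem_map]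
    cases r with
    | nil =>
      constructor
      · rintro (h | ⟨t, -, h⟩)
        · simp only [Sigma.mk.injEq, heq_eq_eq, Prod.mk.injEq, true_and] at h
          simpa using h
        · obtain ⟨rfl, h⟩ := Sigma.mk.inj_iff.1 h
          simp at h
      · rintro rfl
        exact Or.inl rfl
    | cons r b =>
      constructor
      · rintro (h | ⟨t, ht, h⟩)
        · obtain ⟨rfl, h⟩ := Sigma.mk.inj_iff.1 h
          simp at h
        · obtain ⟨t1, t2, t3⟩ := t
          obtain ⟨rfl, h⟩ := Sigma.mk.inj_iff.1 h
          simp only [heq_eq_eq, Prod.mk.injEq] at h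
          obtain ⟨rfl, h'⟩ := h
          obtain ⟨rfl, h1, h2⟩ := Quiver.Path.cons.inj h'
          cases h1; cases h2
          have := (ih _).1 ht
          simpa using this
      · intro h
        simp only [Quiver.Path.comp_cons] at h
        obtain ⟨rfl, h1, h2⟩ := Quiver.Path.cons.inj h
        cases h1; cases h2
        exact Or.inr ⟨⟨k, q, r⟩, (ih _).2 rfl, rfl⟩

theorem Quiver.Path.nodup_splittings {i j : V} (p : Quiver.Path i j) : p.splittings.Nodup := by
  induction p with
  | nil => simp [Quiver.Path.splittings]
  | cons p a ih =>
    simp only [Quiver.Path.splittings, List.nodup_cons, List.mem_map]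
    refine ⟨?_, ih.map ?_⟩
    · rintro ⟨⟨k, q, r⟩, -, h⟩
      obtain ⟨rfl, h⟩ := Sigma.mk.inj_iff.1 h
      simp at h
    · rintro ⟨k, q, r⟩ ⟨k', q', r'⟩ h
      obtain ⟨rfl, h⟩ := Sigma.mk.inj_iff.1 h
      simpa using h

variable (V) in
/-- The completed path algebra `ℂ⟪Q⟫ = ∏ₘ ℂ Qₘ`: since there are only finitely many paths of each
length, its elements are the families of complex coefficients indexed by all paths. -/
def CompletedPathAlgebra : Type := ∀ i j : V, Quiver.Path i j → ℂ

namespace CompletedPathAlgebra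

noncomputable instance : AddCommGroup (CompletedPathAlgebra V) :=
  inferInstanceAs (AddCommGroup (∀ i j : V, Quiver.Path i j → ℂ))

noncomputable instance : Module ℂ (CompletedPathAlgebra V) :=
  inferInstanceAs (Module ℂ (∀ i j : V, Quiver.Path i j → ℂ))

/-- The sum of `F r * g q` over all ways to write `p` as "first `q`, then `r`". -/
noncomputable def conv {i j : V} (F : ∀ k : V, Quiver.Path k j → ℂ)
    (g : ∀ k : V, Quiver.Path i k → ℂ) (p : Quiver.Path i j) : ℂ :=
  (p.splittings.map fun s => F s.1 s.2.2 * g s.1 s.2.1).sum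

theorem conv_nil {i : V} (F : ∀ k : V, Quiver.Path k i → ℂ) (g : ∀ k : V, Quiver.Path i k → ℂ) :
    conv F g .nil = F i .nil * g i .nil := by
  simp [conv, Quiver.Path.splittings]

theorem conv_cons {i j l : V} (F : ∀ k : V, Quiver.Path k l → ℂ)
    (g : ∀ k : V, Quiver.Path i k → ℂ) (p : Quiver.Path i j) (a : j ⟶ l) :
    conv F g (p.cons a) =
      F l .nil * g l (p.cons a) + conv (fun k r => F k (r.cons a)) g p := by
  simp [conv, Quiver.Path.splittings, Function.comp_def]

theorem conv_add_left {i j : V} (F F' : ∀ k : V, Quiver.Path k j → ℂ)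
    (g : ∀ k : V, Quiver.Path i k → ℂ) (p : Quiver.Path i j) :
    conv (fun k r => F k r + F' k r) g p = conv F g p + conv F' g p := by
  simp [conv, add_mul, List.sum_map_add]

theorem conv_add_right {i j : V} (F : ∀ k : V, Quiver.Path k j → ℂ)
    (g g' : ∀ k : V, Quiver.Path i k → ℂ) (p : Quiver.Path i j) :
    conv F (fun k r => g k r + g' k r) p = conv F g p + conv F g' p := by
  simp [conv, mul_add, List.sum_map_add]

theorem conv_smul_left {i j : V} (c : ℂ) (F : ∀ k : V, Quiver.Path k j → ℂ)
    (g : ∀ k : V, Quiver.Path i k → ℂ) (p : Quiver.Path i j) :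
    conv (fun k r => c * F k r) g p = c * conv F g p := by
  simp [conv, mul_assoc, List.sum_map_mul_left]

theorem conv_smul_right {i j : V} (c : ℂ) (F : ∀ k : V, Quiver.Path k j → ℂ)
    (g : ∀ k : V, Quiver.Path i k → ℂ) (p : Quiver.Path i j) :
    conv F (fun k r => c * g k r) p = c * conv F g p := by
  simp [conv, mul_left_comm _ c, List.sum_map_mul_left]

theorem conv_assoc {i j : V} (F : ∀ k : V, Quiver.Path k j → ℂ)
    (g : ∀ k l : V, Quiver.Path k l → ℂ) (h : ∀ k : V, Quiver.Path i k → ℂ)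
    (p : Quiver.Path i j) :
    conv (fun k r => conv F (g k) r) h p =
      conv F (fun k q => conv (fun l r => g l k r) h q) p := by
  induction p with
  | nil => simp [conv_nil, mul_assoc]
  | cons p a ih =>
    simp only [conv_cons, conv_nil, conv_add_left, conv_smul_left, ih]
    ring

/-- The product of the completed path algebra: the coefficient of `f * g` at a path `p` is the sum
of `f r * g q` over all factorizations of `p` as "first `q`, then `r`". -/
noncomputable instance : Mul (CompletedPathAlgebra V) where
  mul f g := fun i j p => conv (fun k r => f k j r) (fun k q => g i k q) p

/-- The unit is the sum of all trivial paths. -/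
noncomputable instance : One (CompletedPathAlgebra V) where
  one := fun _ _ p => if p.length = 0 then 1 else 0

theorem mul_apply (f g : CompletedPathAlgebra V) (i j : V) (p : Quiver.Path i j) :
    (f * g) i j p = conv (fun k r => f k j r) (fun k q => g i k q) p := rfl

theorem one_apply (i j : V) (p : Quiver.Path i j) :
    (1 : CompletedPathAlgebra V) i j p = if p.length = 0 then 1 else 0 := rfl

theorem add_apply (f g : CompletedPathAlgebra V) (i j : V) (p : Quiver.Path i j) :
    (f + g) i j p = f i j p + g i j p := rfl

theorem zero_apply (i j : V) (p : Quiver.Path i j) :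
    (0 : CompletedPathAlgebra V) i j p = 0 := rfl

theorem smul_apply (c : ℂ) (f : CompletedPathAlgebra V) (i j : V) (p : Quiver.Path i j) :
    (c • f) i j p = c * f i j p := rfl

theorem conv_zero_left {i j : V} (g : ∀ k : V, Quiver.Path i k → ℂ) (p : Quiver.Path i j) :
    conv (fun _ _ => 0) g p = 0 := by
  simp [conv]

theorem conv_zero_right {i j : V} (F : ∀ k : V, Quiver.Path k j → ℂ) (p : Quiver.Path i j) :
    conv F (fun _ _ => 0) p = 0 := by
  simp [conv]

noncomputable instance : Ring (CompletedPathAlgebra V) where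
  __ := (inferInstance : AddCommGroup (CompletedPathAlgebra V))
  __ := (inferInstance : Mul (CompletedPathAlgebra V))
  __ := (inferInstance : One (CompletedPathAlgebra V))
  left_distrib f g h := by
    funext i j p
    exact conv_add_right _ _ _ p
  right_distrib f g h := by
    funext i j p
    exact conv_add_left _ _ _ p
  zero_mul f := by
    funext i j p
    exact conv_zero_left _ p
  mul_zero f := by
    funext i j p
    exact conv_zero_right _ p
  mul_assoc f g h := by
    funext i j p
    exact conv_assoc _ _ _ p
  one_mul f := by
    funext i j p
    cases p with
    | nil => simp [mul_apply, one_apply, conv_nil]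
    | cons p a => simp [mul_apply, one_apply, conv_cons, conv_zero_left]
  mul_one f := by
    funext i j p
    rw [mul_apply]
    have key : ∀ {l : V} (q : Quiver.Path i l) (F : ∀ k : V, Quiver.Path k l → ℂ),
        conv F (fun k q => (1 : CompletedPathAlgebra V) i k q) q = F i q := by
      intro l q
      induction q with
      | nil => intro F; simp [one_apply, conv_nil]
      | cons q a ih => intro F; rw [conv_cons, ih]; simp [one_apply]
    exact key p _

noncomputable instance : Algebra ℂ (CompletedPathAlgebra V) :=
  Algebra.ofModule
    (fun c f g => by
      funext i j p
      exact conv_smul_left c _ _ p)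
    (fun c f g => by
      funext i j p
      exact conv_smul_right c _ _ p)

variable (V) in
/-- The power `𝔪ᵐ = ∏_{l ≥ m} ℂ Q_l` of the arrow ideal `𝔪`: the elements all of whose coefficients
at paths of length less than `m` vanish. -/
def arrowIdealPow (m : ℕ) : Ideal (CompletedPathAlgebra V) where
  carrier := {f | ∀ (i j : V) (p : Quiver.Path i j), p.length < m → f i j p = 0}
  add_mem' := by
    intro f g hf hg i j p hp
    rw [add_apply, hf i j p hp, hg i j p hp, add_zero]
  zero_mem' := fun _ _ _ _ => rfl
  smul_mem' := by
    intro f g hg i j p hp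
    rw [smul_eq_mul, mul_apply, conv]
    apply List.sum_eq_zero
    intro x hx
    obtain ⟨s, hs, rfl⟩ := List.mem_map.1 hx
    have h := congrArg Quiver.Path.length ((p.mem_splittings s).1 hs)
    rw [Quiver.Path.length_comp] at h
    rw [hg i s.1 s.2.1 (by omega), mul_zero]

end CompletedPathAlgebra

end PathAlgebra

/-- A basic algebra `Λ = ℂ⟪Q⟫ / I`, given by a two-sided ideal `I` of the completed path algebra
which is admissible in the sense that `I ⊆ 𝔪²`. -/
structure BasicAlgebra (V : Type) [Quiver.{0} V] where
  ideal : Ideal (CompletedPathAlgebra V)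
  isTwoSided : ideal.IsTwoSided
  admissible : ideal ≤ CompletedPathAlgebra.arrowIdealPow V 2

attribute [instance] BasicAlgebra.isTwoSided

/-- The underlying `ℂ`-algebra `ℂ⟪Q⟫ / I` of a basic algebra. -/
abbrev BasicAlgebra.Alg {V : Type} [Quiver.{0} V] (Λ : BasicAlgebra V) : Type :=
  CompletedPathAlgebra V ⧸ Λ.ideal

universe u

/-! ## Representations -/

/-- A finite-dimensional complex representation of a quiver. -/
structure QuiverRep (V : Type) [Quiver.{0} V] where
  space : V → Type u
  [addCommGroup : ∀ i, AddCommGroup (space i)]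
  [module : ∀ i, Module ℂ (space i)]
  [finiteDimensional : ∀ i, FiniteDimensional ℂ (space i)]
  map : ∀ {i j : V}, (i ⟶ j) → (space i →ₗ[ℂ] space j)

attribute [instance] QuiverRep.addCommGroup QuiverRep.module QuiverRep.finiteDimensional

namespace QuiverRep

variable {V : Type} [Quiver.{0} V] (M : QuiverRep.{u} V)

/-- The linear map `M_p` attached to a path `p`. -/
def pathMap {i : V} : {j : V} → Quiver.Path i j → (M.space i →ₗ[ℂ] M.space j)
  | _, .nil => LinearMap.id
  | _, .cons p a => (M.map a).comp (pathMap p)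

/-- A representation is nilpotent if all sufficiently long paths act as zero. -/
def IsNilpotent : Prop :=
  ∃ N : ℕ, ∀ (i j : V) (p : Quiver.Path i j), N < p.length → M.pathMap p = 0

/-- The map `M_i → M_j` induced by an element `f` of the completed path algebra, namely the sum of
`f(p) M_p` over all paths `p` from `i` to `j`. For nilpotent `M` only finitely many terms are
nonzero. -/
noncomputable def eval (f : CompletedPathAlgebra V) (i j : V) : M.space i →ₗ[ℂ] M.space j :=
  ∑ᶠ p : Quiver.Path i j, f i j p • M.pathMap p

/-- `M` is annihilated by the ideal `I`. -/
def IsAnnihilatedBy (I : Ideal (CompletedPathAlgebra V)) : Prop :=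
  ∀ f ∈ I, ∀ i j : V, M.eval f i j = 0

theorem pathMap_comp {i j k : V} (p : Quiver.Path i j) (q : Quiver.Path j k) :
    M.pathMap (p.comp q) = (M.pathMap q).comp (M.pathMap p) := by
  induction q with
  | nil => rfl
  | cons q a ih => rw [Quiver.Path.comp_cons, pathMap, ih, pathMap, LinearMap.comp_assoc]

theorem finite_paths [Finite V] [∀ i j : V, Finite (i ⟶ j)] (i j : V) (N : ℕ) :
    {p : Quiver.Path i j | p.length ≤ N}.Finite := by
  induction N generalizing j with
  | zero =>
    by_cases h : i = j
    · subst h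
      refine (Set.finite_singleton (Quiver.Path.nil : Quiver.Path i i)).subset ?_
      intro p hp
      exact Quiver.Path.eq_nil_of_length_zero p (by simpa using hp)
    · refine Set.finite_empty.subset ?_
      intro p hp
      exact h (Quiver.Path.eq_of_length_zero p (by simpa using hp))
  | succ N ih =>
    have h1 : (⋃ b : V, ⋃ a : b ⟶ j,
        (fun p : Quiver.Path i b => p.cons a) '' {p | p.length ≤ N}).Finite :=
      Set.finite_iUnion fun b => Set.finite_iUnion fun a => (ih b).image _
    refine ((ih j).union h1).subset ?_
    intro p hp
    cases p with
    | nil => left; simp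
    | cons p a =>
      right
      simp only [Set.mem_iUnion]
      exact ⟨_, a, p, by simpa using hp, rfl⟩

variable {M}

theorem eval_eq_sum {N : ℕ} (hN : ∀ (i j : V) (p : Quiver.Path i j), N < p.length → M.pathMap p = 0)
    (f : CompletedPathAlgebra V) {i j : V} (T : Finset (Quiver.Path i j))
    (hT : ∀ p : Quiver.Path i j, p.length ≤ N → p ∈ T) :
    M.eval f i j = ∑ p ∈ T, f i j p • M.pathMap p := by
  apply finsum_eq_sum_of_support_subset
  intro p hp
  by_contra h
  have : N < p.length := by
    by_contra h'
    exact h (hT p (by omega))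
  exact hp (by simp [hN i j p this])

theorem eval_mul [Fintype V] [∀ i j : V, Finite (i ⟶ j)] (hM : M.IsNilpotent)
    (f g : CompletedPathAlgebra V) (i j : V) :
    M.eval (f * g) i j = ∑ k, (M.eval f k j).comp (M.eval g i k) := by
  classical
  obtain ⟨N, hN⟩ := hM
  let P (m : ℕ) (a b : V) : Finset (Quiver.Path a b) := (finite_paths a b m).toFinset
  have hP (m : ℕ) (a b : V) (p : Quiver.Path a b) : p ∈ P m a b ↔ p.length ≤ m := by simp [P]
  rw [eval_eq_sum hN (f * g) (P (N + N) i j) (fun p hp => (hP _ _ _ _).2 (by omega))]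
  let G : (Σ k : V, Quiver.Path i k × Quiver.Path k j) → (M.space i →ₗ[ℂ] M.space j) := fun s =>
    (f s.1 j s.2.2 * g i s.1 s.2.1) • (M.pathMap s.2.2).comp (M.pathMap s.2.1)
  let T : Finset (Σ k : V, Quiver.Path i k × Quiver.Path k j) :=
    Finset.univ.sigma fun k => P N i k ×ˢ P N k j
  have hR : ∑ k, (M.eval f k j).comp (M.eval g i k) = ∑ s ∈ T, G s := by
    rw [Finset.sum_sigma]
    refine Finset.sum_congr rfl fun k _ => ?_
    rw [eval_eq_sum hN f (P N k j) (fun p hp => (hP _ _ _ _).2 hp),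
      eval_eq_sum hN g (P N i k) (fun p hp => (hP _ _ _ _).2 hp), Finset.sum_product_right]
    ext v
    simp [G, LinearMap.sum_apply, map_sum, Finset.smul_sum, mul_smul]
  rw [hR, ← Finset.sum_fiberwise_of_maps_to (s := T) (t := P (N + N) i j)
    (g := fun s => s.2.1.comp s.2.2)]
  · refine Finset.sum_congr rfl fun p _ => ?_
    have h1 : (f * g) i j p • M.pathMap p = ∑ s ∈ p.splittings.toFinset, G s := by
      rw [List.sum_toFinset _ p.nodup_splittings, CompletedPathAlgebra.mul_apply,
        CompletedPathAlgebra.conv, List.sum_smul, List.map_map]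
      congr 1
      refine List.map_congr_left fun s hs => ?_
      simp only [Function.comp_apply, G]
      rw [← M.pathMap_comp, (p.mem_splittings s).1 hs]
    rw [h1]
    symm
    apply Finset.sum_subset
    · intro s hs
      rw [List.mem_toFinset, p.mem_splittings]
      exact (Finset.mem_filter.1 hs).2
    · intro s hs hs'
      rw [List.mem_toFinset, p.mem_splittings] at hs
      have : ¬ (s.2.1.length ≤ N ∧ s.2.2.length ≤ N) := by
        intro h
        apply hs'
        rw [Finset.mem_filter]
        refine ⟨?_, hs⟩
        simp only [T, Finset.mem_sigma, Finset.mem_univ, true_and, Finset.mem_product, hP]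
        exact h
      by_cases h : s.2.1.length ≤ N
      · have : M.pathMap s.2.2 = 0 := hN _ _ _ (by omega)
        simp [G, this]
      · have : M.pathMap s.2.1 = 0 := hN _ _ _ (by omega)
        simp [G, this]
  · intro s hs
    simp only [T, Finset.mem_sigma, Finset.mem_univ, true_and, Finset.mem_product, hP] at hs
    rw [hP, Quiver.Path.length_comp]
    omega

theorem eval_add [Finite V] [∀ i j : V, Finite (i ⟶ j)] (hM : M.IsNilpotent)
    (f g : CompletedPathAlgebra V) (i j : V) :
    M.eval (f + g) i j = M.eval f i j + M.eval g i j := by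
  obtain ⟨N, hN⟩ := hM
  have h : ∀ p : Quiver.Path i j, p.length ≤ N → p ∈ (finite_paths i j N).toFinset := by simp
  rw [eval_eq_sum hN _ _ h, eval_eq_sum hN _ _ h, eval_eq_sum hN _ _ h, ← Finset.sum_add_distrib]
  refine Finset.sum_congr rfl fun p _ => ?_
  rw [CompletedPathAlgebra.add_apply, add_smul]

theorem eval_zero (i j : V) : M.eval 0 i j = 0 := by
  simp [eval, CompletedPathAlgebra.zero_apply]

theorem eval_one_self (i : V) : M.eval 1 i i = LinearMap.id := by
  rw [eval, finsum_eq_single _ Quiver.Path.nil]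
  · simp [CompletedPathAlgebra.one_apply, pathMap]
  · intro p hp
    have : p.length ≠ 0 := fun h => hp (Quiver.Path.eq_nil_of_length_zero p h)
    simp [CompletedPathAlgebra.one_apply, this]

theorem eval_one_of_ne {i j : V} (h : i ≠ j) : M.eval 1 i j = 0 := by
  rw [eval]
  apply finsum_eq_zero_of_forall_eq_zero
  intro p
  have : p.length ≠ 0 := fun h' => h (Quiver.Path.eq_of_length_zero p h')
  simp [CompletedPathAlgebra.one_apply, this]

end QuiverRep

/-- A representation of `Λ = ℂ⟪Q⟫ / I`: a nilpotent finite-dimensional representation of the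
quiver which is annihilated by `I`. -/
structure BasicAlgebra.Rep {V : Type} [Quiver.{0} V] (Λ : BasicAlgebra V) extends
    QuiverRep.{u} V where
  nilpotent : toQuiverRep.IsNilpotent
  annihilated : toQuiverRep.IsAnnihilatedBy Λ.ideal

namespace BasicAlgebra

variable {V : Type} [Quiver.{0} V] {Λ : BasicAlgebra V}

/-- The total space `⨁ᵢ Mᵢ` of a representation (the set of vertices being finite). -/
def Rep.Total (M : Rep.{u} Λ) : Type u := ∀ i, M.space i

namespace Rep

variable [Fintype V] [∀ i j : V, Finite (i ⟶ j)] (M : Rep.{u} Λ)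

instance : AddCommGroup M.Total := inferInstanceAs (AddCommGroup (∀ i, M.space i))

/-- The action of the completed path algebra on the total space. -/
noncomputable instance : Module (CompletedPathAlgebra V) M.Total where
  smul f v := fun j => ∑ i, M.eval f i j (v i)
  one_smul v := by
    classical
    funext j
    change ∑ i, M.eval 1 i j (v i) = v j
    rw [Finset.sum_eq_single j]
    · rw [QuiverRep.eval_one_self]; rfl
    · intro i _ hi
      rw [QuiverRep.eval_one_of_ne hi]; rfl
    · simp
  mul_smul f g v := by
    funext j
    change ∑ i, M.eval (f * g) i j (v i) = ∑ k, M.eval f k j (∑ i, M.eval g i k (v i))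
    simp only [QuiverRep.eval_mul M.nilpotent, LinearMap.sum_apply, LinearMap.comp_apply, map_sum]
    exact Finset.sum_comm
  smul_zero f := by
    funext j
    change ∑ i, M.eval f i j 0 = 0
    simp
  smul_add f v w := by
    funext j
    change ∑ i, M.eval f i j (v i + w i) = ∑ i, M.eval f i j (v i) + ∑ i, M.eval f i j (w i)
    simp [Finset.sum_add_distrib]
  add_smul f g v := by
    funext j
    change ∑ i, M.eval (f + g) i j (v i) = ∑ i, M.eval f i j (v i) + ∑ i, M.eval g i j (v i)
    simp [QuiverRep.eval_add M.nilpotent, Finset.sum_add_distrib]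
  zero_smul v := by
    funext j
    change ∑ i, M.eval 0 i j (v i) = 0
    simp [QuiverRep.eval_zero]

theorem isTorsionBySet :
    Module.IsTorsionBySet (CompletedPathAlgebra V) M.Total (Λ.ideal : Set _) := by
  rintro v ⟨f, hf⟩
  funext j
  change ∑ i, M.eval f i j (v i) = 0
  simp [M.annihilated f hf]

/-- The `Λ`-module structure on the total space of a representation of `Λ`. -/
noncomputable instance : Module Λ.Alg M.Total := M.isTorsionBySet.module

/-- A representation of `Λ`, seen as an object of the category of all left `Λ`-modules. -/
noncomputable def toModuleCat : ModuleCat.{u} Λ.Alg := ModuleCat.of Λ.Alg M.Total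

end Rep

variable (Λ) in
/-- The simple representation `S_i`: its space at `i` is `ℂ` (functions from a one-point type),
its space at any `j ≠ i` is zero (functions from an empty type), and all arrows act as zero. -/
noncomputable def simple (i : V) : Rep.{u} Λ where
  space j := PLift (j = i) → ULift.{u} ℂ
  map _ := 0
  nilpotent := by
    refine ⟨0, fun a b p hp => ?_⟩
    cases p with
    | nil => simp at hp
    | cons p c => exact LinearMap.zero_comp _
  annihilated := by
    intro f hf a b
    apply finsum_eq_zero_of_forall_eq_zero
    intro p
    cases p with
    | nil => rw [Λ.admissible hf _ _ _ (by simp), zero_smul]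
    | cons p c =>
      rw [QuiverRep.pathMap, LinearMap.zero_comp, smul_zero]

variable (Λ) in
/-- A decorated representation `(M, V)` of `Λ`: a representation `M` of `Λ` together with a
finite-dimensional complex vector space for every vertex. -/
structure DecRep where
  rep : Rep.{u} Λ
  deco : V → Type u
  [addCommGroup : ∀ i, AddCommGroup (deco i)]
  [module : ∀ i, Module ℂ (deco i)]
  [finiteDimensional : ∀ i, FiniteDimensional ℂ (deco i)]

attribute [instance] DecRep.addCommGroup DecRep.module DecRep.finiteDimensional

/-- The `g`-vector of a decorated representation `(M, V)`:
`gᵢ = - dim Hom_Λ(Sᵢ, M) + dim Ext¹_Λ(Sᵢ, M) + dim Vᵢ`. -/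
noncomputable def DecRep.gVector [Fintype V] [∀ i j : V, Finite (i ⟶ j)] (M : DecRep.{u} Λ) :
    V → ℤ := fun i =>
  - (Module.finrank ℂ ((simple.{u} Λ i).toModuleCat ⟶ M.rep.toModuleCat) : ℤ)
    + (Module.finrank ℂ (CategoryTheory.Abelian.Ext.{u} (simple.{u} Λ i).toModuleCat M.rep.toModuleCat 1) : ℤ)
    + (Module.finrank ℂ (M.deco i) : ℤ)

end BasicAlgebra

/-! ## Quiver Grassmannians and their Euler characteristic -/

/-- The Grassmannian of `k`-dimensional subspaces of a complex vector space `W`. -/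
def ComplexGrassmannian (k : ℕ) (W : Type u) [AddCommGroup W] [Module ℂ W] : Type u :=
  {U : Submodule ℂ W // Module.finrank ℂ U = k}

/-- The subspace spanned by a linearly independent `k`-tuple. -/
noncomputable def ComplexGrassmannian.ofFrame (k : ℕ) (W : Type u) [AddCommGroup W] [Module ℂ W]
    (v : {v : Fin k → W // LinearIndependent ℂ v}) : ComplexGrassmannian k W :=
  ⟨Submodule.span ℂ (Set.range v.1), by simpa using finrank_span_eq_card v.2⟩

/-- The classical topology on the Grassmannian of a finite-dimensional complex vector space `W`: the
quotient topology under the map sending a linearly independent `k`-tuple of vectors (the tuples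
having the subspace topology of `W ^ k`, where `W` has its canonical vector space topology) to its
span. -/
noncomputable instance (k : ℕ) (W : Type u) [AddCommGroup W] [Module ℂ W] :
    TopologicalSpace (ComplexGrassmannian k W) :=
  letI : TopologicalSpace W := moduleTopology ℂ W
  TopologicalSpace.coinduced (ComplexGrassmannian.ofFrame k W) inferInstance

/-- The quiver Grassmannian `Gr_e(M)`: subrepresentations of `M` of dimension vector `e`. -/
def QuiverRep.Grassmannian {V : Type} [Quiver.{0} V] (M : QuiverRep.{u} V) (e : V → ℕ) : Type u :=
  {U : ∀ i, ComplexGrassmannian (e i) (M.space i) //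
    ∀ (i j : V) (a : i ⟶ j), (U i).1.map (M.map a) ≤ (U j).1}

/-- `Gr_e(M)` as a subspace of the product of the ordinary Grassmannians, with the classical
topology. -/
noncomputable instance {V : Type} [Quiver.{0} V] (M : QuiverRep.{u} V) (e : V → ℕ) :
    TopologicalSpace (M.Grassmannian e) :=
  inferInstanceAs (TopologicalSpace
    {U : ∀ i, ComplexGrassmannian (e i) (M.space i) //
      ∀ (i j : V) (a : i ⟶ j), (U i).1.map (M.map a) ≤ (U j).1})

/-- The Euler–Poincaré characteristic of a topological space: the alternating sum of the dimensions
of its singular homology groups with rational coefficients. -/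
noncomputable def eulerPoincareChar (X : Type u) [TopologicalSpace X] : ℤ :=
  (((AlgebraicTopology.singularChainComplexFunctor (ModuleCat.{u} ℚ)).obj
    (ModuleCat.of ℚ (ULift.{u} ℚ))).obj (TopCat.of X)).homologyEulerChar

/-! ## Caldero–Chapoton functions -/

/-- The skew-symmetric matrix `B_Q`, with
`b_{ij} = #{arrows j → i} - #{arrows i → j}`. -/
noncomputable def quiverMatrix (V : Type) [Quiver.{0} V] : Matrix V V ℤ :=
  Matrix.of fun i j => (Nat.card (j ⟶ i) : ℤ) - (Nat.card (i ⟶ j) : ℤ)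

/-- The Laurent polynomial ring `R[x_i^{±1} : i ∈ V]`: the monomial `x^a` with `a ∈ ℤ^V` is
`AddMonoidAlgebra.single a 1`. -/
abbrev LaurentRing (R : Type) [Ring R] (V : Type) : Type := AddMonoidAlgebra R (V → ℤ)

namespace BasicAlgebra

variable {V : Type} [Quiver.{0} V] {Λ : BasicAlgebra V} [Fintype V] [∀ i j : V, Finite (i ⟶ j)]

/-- The Caldero–Chapoton function
`C_Λ(M, V) = x^{g(M, V)} ∑_{e ∈ ℕ^n} χ(Gr_e(M)) x^{B_Q e}` as a Laurent polynomial over `ℤ`.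
Only finitely many of the quiver Grassmannians are non-empty. -/
noncomputable def DecRep.ccFunctionInt (M : DecRep.{u} Λ) : LaurentRing ℤ V :=
  AddMonoidAlgebra.single M.gVector 1 *
    ∑ᶠ e : V → ℕ, eulerPoincareChar (M.rep.Grassmannian e) •
      (AddMonoidAlgebra.single ((quiverMatrix V).mulVec fun i => (e i : ℤ)) 1 : LaurentRing ℤ V)

/-- The Caldero–Chapoton function as an element of `ℂ[x_1^{±1}, …, x_n^{±1}]`. -/
noncomputable def DecRep.ccFunction (M : DecRep.{u} Λ) : LaurentRing ℂ V :=
  AddMonoidAlgebra.mapRingHom (V → ℤ) (Int.castRingHom ℂ) M.ccFunctionInt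

variable (Λ) in
/-- The Caldero–Chapoton algebra `𝒜_Λ`: the `ℂ`-subalgebra of `ℂ[x_1^{±1}, …, x_n^{±1}]` generated by
all Caldero–Chapoton functions of decorated representations of `Λ`. -/
noncomputable def ccAlgebra : Subalgebra ℂ (LaurentRing ℂ V) :=
  Algebra.adjoin ℂ (Set.range fun M : DecRep.{u} Λ => M.ccFunction)

/-- The Caldero–Chapoton function as an element of the Caldero–Chapoton algebra. -/
noncomputable def DecRep.ccElement (M : DecRep.{u} Λ) : ccAlgebra.{u} Λ :=
  ⟨M.ccFunction, Algebra.subset_adjoin ⟨M, rfl⟩⟩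

end BasicAlgebra

/-! Write `g` for the g-vector of a decorated representation. All exponents of its Caldero–Chapoton
function lie in the translate `g + B_Q ℕ^n`, because each term of the sum is shifted by some `B_Q
e`. Condition 1 has two consequences, both obtained from `eq_zero_of_quiverMatrix_mulVec_eq_zero`.
The cone `B_Q ℕ^n` contains no nonzero vector together with its negative (`quiverCone_pointed`).
Moreover only `e = 0` contributes to `x^g`, so the coefficient there is `χ(Gr_0(M)) = 1`
(`DecRep.coeff_ccFunction_gVector`). A vanishing linear combination is then impossible: among the
finitely many indices with nonzero coefficient, choose one whose apex `g` lies in no translated cone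
of another. The monomial `x^g` occurs in that function alone and cannot cancel
(`AddMonoidAlgebra.linearIndependent_of_pointed`). The only geometric input is the Euler
characteristic of a point and of the empty space, so no finer topology of quiver Grassmannians
enters. -/

/-! ### Euler characteristic of a point and of the empty space. -/

-- Singular homology of a totally disconnected space is concentrated in degree 0, where it is a
-- direct sum of copies of `ℚ` indexed by the points. If there are infinitely many points, both
-- sides take the default value 0 of `finrank`; only the one-point and empty cases are needed.
open CategoryTheory CategoryTheory.Limits in
theorem eulerPoincareChar_eq_finrank_sigma (X : Type u) [TopologicalSpace X]
    [TotallyDisconnectedSpace X] :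
    eulerPoincareChar X =
      Module.finrank ℚ (∐ fun _ : X => ModuleCat.of ℚ (ULift.{u} ℚ) : ModuleCat.{u} ℚ) := by
  have : TotallyDisconnectedSpace (TopCat.of X) := ‹_›
  rw [eulerPoincareChar,
    HomologicalComplex.homologyEulerChar_eq_sum_finSet_of_finrankSupport_subset _ {0}]
  · rw [Finset.sum_singleton]
    have e := (AlgebraicTopology.singularHomologyFunctorZeroOfTotallyDisconnectedSpace
      (ModuleCat.{u} ℚ) (ModuleCat.of ℚ (ULift.{u} ℚ)) (TopCat.of X)).toLinearEquiv.finrank_eq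
    simp only [ComplexShape.χ, ComplexShape.eulerCharSignsDownNat_χ, pow_zero, Units.val_one,
      one_mul, Nat.cast_inj]
    exact e
  · rw [GradedObject.finrankSupport_subset_iff]
    intro n hn
    have hn' : n ≠ 0 := by simpa using hn
    have hz : IsZero ((((AlgebraicTopology.singularChainComplexFunctor (ModuleCat.{u} ℚ)).obj
        (ModuleCat.of ℚ (ULift.{u} ℚ))).obj (TopCat.of X)).homology n) :=
      AlgebraicTopology.isZero_singularHomologyFunctor_of_totallyDisconnectedSpace
        (ModuleCat.{u} ℚ) n (ModuleCat.of ℚ (ULift.{u} ℚ)) (TopCat.of X) hn'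
    have := ModuleCat.subsingleton_of_isZero hz
    exact Module.finrank_zero_of_subsingleton

open CategoryTheory CategoryTheory.Limits in
theorem eulerPoincareChar_of_unique (X : Type u) [TopologicalSpace X] [Unique X] :
    eulerPoincareChar X = 1 := by
  rw [eulerPoincareChar_eq_finrank_sigma,
    (coproductUniqueIso fun _ : X => ModuleCat.of ℚ (ULift.{u} ℚ)).toLinearEquiv.finrank_eq]
  exact congrArg Nat.cast ((ULift.moduleEquiv (R := ℚ) (M := ℚ)).finrank_eq.trans
    (Module.finrank_self ℚ))

open CategoryTheory CategoryTheory.Limits in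
theorem eulerPoincareChar_of_isEmpty (X : Type u) [TopologicalSpace X] [IsEmpty X] :
    eulerPoincareChar X = 0 := by
  rw [eulerPoincareChar_eq_finrank_sigma]
  have hz : IsZero (∐ fun _ : X => ModuleCat.of ℚ (ULift.{u} ℚ) : ModuleCat.{u} ℚ) := by
    rw [IsZero.iff_id_eq_zero]
    exact Sigma.hom_ext _ _ fun x => isEmptyElim x
  have := ModuleCat.subsingleton_of_isZero hz
  rw [Module.finrank_zero_of_subsingleton, Nat.cast_zero]

/-! ### Quiver Grassmannians: the zero dimension vector and finiteness. -/

namespace QuiverRep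

variable {V : Type} [Quiver.{0} V] (M : QuiverRep.{u} V)

/-- The zero subrepresentation is the only one of dimension vector zero. -/
theorem nonempty_unique_grassmannian_zero : Nonempty (Unique (M.Grassmannian 0)) :=
  ⟨{ default := ⟨fun _ => ⟨⊥, finrank_bot _ _⟩, fun i j a => by simp⟩
     uniq := fun U => Subtype.ext (funext fun i => Subtype.ext
       (Submodule.finrank_eq_zero.1 (U.1 i).2)) }⟩

theorem eulerPoincareChar_grassmannian_zero : eulerPoincareChar (M.Grassmannian 0) = 1 :=
  have := M.nonempty_unique_grassmannian_zero.some
  eulerPoincareChar_of_unique _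

theorem le_finrank_of_eulerPoincareChar_grassmannian_ne_zero {e : V → ℕ}
    (h : eulerPoincareChar (M.Grassmannian e) ≠ 0) :
    e ≤ fun i => Module.finrank ℂ (M.space i) := by
  by_contra he
  have : IsEmpty (M.Grassmannian e) :=
    ⟨fun U => he fun i => (U.1 i).2 ▸ Submodule.finrank_le (U.1 i).1⟩
  exact h (eulerPoincareChar_of_isEmpty _)

/-- A nonzero Euler characteristic needs a subrepresentation, which bounds `e` by the dimension
vector of `M`. Without finiteness the `∑ᶠ` defining the Caldero–Chapoton function could collapse to
its default value 0. -/
theorem finite_support_eulerPoincareChar_grassmannian [Finite V] :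
    (Function.support fun e => eulerPoincareChar (M.Grassmannian e)).Finite := by
  classical
  have := Fintype.ofFinite V
  exact (Set.finite_Iic _).subset fun e he =>
    M.le_finrank_of_eulerPoincareChar_grassmannian_ne_zero he

end QuiverRep

/-! ### The cone `B_Q ℕ^n` and its pointedness. -/

theorem quiverMatrix_mulVec_zero {V : Type} [Fintype V] [Quiver.{0} V] :
    (quiverMatrix V).mulVec (fun i => (((0 : V → ℕ) i : ℕ) : ℤ)) = 0 :=
  (congrArg (quiverMatrix V).mulVec (funext fun _ => Nat.cast_zero)).trans (Matrix.mulVec_zero _)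

/-- The submonoid `B_Q ℕ^n` of `ℤ^n`. -/
def quiverCone (V : Type) [Fintype V] [Quiver.{0} V] : AddSubmonoid (V → ℤ) where
  carrier := Set.range fun e : V → ℕ => (quiverMatrix V).mulVec fun i => (e i : ℤ)
  zero_mem' := ⟨0, quiverMatrix_mulVec_zero⟩
  add_mem' := by
    rintro _ _ ⟨e, rfl⟩ ⟨e', rfl⟩
    refine ⟨e + e', ?_⟩
    simp only [← Matrix.mulVec_add]
    congr 1

theorem eq_zero_of_quiverMatrix_mulVec_eq_zero {V : Type} [Fintype V] [Quiver.{0} V]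
    (hB : (LinearMap.ker ((quiverMatrix V).map (Int.cast : ℤ → ℚ)).mulVecLin : Set (V → ℚ)) ∩
      {a | ∀ i, 0 ≤ a i} = {0}) {e : V → ℕ}
    (he : (quiverMatrix V).mulVec (fun i => (e i : ℤ)) = 0) : e = 0 := by
  have h : (fun i => (e i : ℚ)) ∈ ({0} : Set (V → ℚ)) := by
    rw [← hB]
    refine ⟨?_, fun i => Nat.cast_nonneg _⟩
    rw [SetLike.mem_coe, LinearMap.mem_ker, Matrix.mulVecLin_apply]
    funext i
    have := congrArg (Int.cast : ℤ → ℚ) (congrFun he i)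
    simpa [Matrix.mulVec, dotProduct] using this
  funext i
  simpa using congrFun h i

/-- If `B_Q e' = -B_Q e`, then `e + e'` is a non-negative kernel vector, hence zero by condition 1;
natural numbers with zero sum are zero, so already `e = 0`. -/
theorem quiverCone_pointed {V : Type} [Fintype V] [Quiver.{0} V]
    (hB : (LinearMap.ker ((quiverMatrix V).map (Int.cast : ℤ → ℚ)).mulVecLin : Set (V → ℚ)) ∩
      {a | ∀ i, 0 ≤ a i} = {0}) (a : V → ℤ) (ha : a ∈ quiverCone V) (ha' : -a ∈ quiverCone V) :
    a = 0 := by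
  obtain ⟨e, rfl⟩ := ha
  obtain ⟨e', he'⟩ := ha'
  have h : e + e' = 0 := by
    apply eq_zero_of_quiverMatrix_mulVec_eq_zero hB
    have := eq_neg_iff_add_eq_zero.1 he'
    rw [← Matrix.mulVec_add] at this
    rw [← this]
    congr 1
    funext i
    simp [add_comm]
  obtain rfl : e = 0 := (add_eq_zero.1 h).1
  exact quiverMatrix_mulVec_zero

/-! ### Coefficients of the Caldero–Chapoton function. -/

namespace BasicAlgebra

variable {V : Type} [Quiver.{0} V] {Λ : BasicAlgebra V} [Fintype V] [∀ i j : V, Finite (i ⟶ j)]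

/-- The `Finsupp.single` factor is the indicator of `B_Q e = a - g`; the shift by `-g` undoes the
multiplication by `x^g`. -/
theorem DecRep.coeff_ccFunction (M : DecRep.{u} Λ) (a : V → ℤ) :
    M.ccFunction.coeff a = ((∑ᶠ e : V → ℕ, eulerPoincareChar (M.rep.Grassmannian e) *
      (Finsupp.single ((quiverMatrix V).mulVec fun i => (e i : ℤ)) (1 : ℤ))
        (-M.gVector + a) : ℤ) : ℂ) := by
  have hfin := (M.rep.finite_support_eulerPoincareChar_grassmannian).subset
    (Function.support_smul_subset_left (fun e => eulerPoincareChar (M.rep.Grassmannian e))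
      (fun e => (AddMonoidAlgebra.single ((quiverMatrix V).mulVec fun i => (e i : ℤ)) 1 :
        LaurentRing ℤ V)))
  rw [DecRep.ccFunction, AddMonoidAlgebra.coeff_mapRingHom, DecRep.ccFunctionInt,
    AddMonoidAlgebra.coeff_single_mul_apply, one_mul]
  -- Extracting a coefficient is additive, so it commutes with a `∑ᶠ` of finite support.
  have h := ((Finsupp.applyAddHom (M := ℤ) (-M.gVector + a)).comp
    (AddMonoidAlgebra.coeffAddEquiv (R := ℤ) (M := V → ℤ)).toAddMonoidHom).map_finsum hfin
  exact congrArg (Int.cast : ℤ → ℂ) h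

theorem DecRep.coeff_ccFunction_gVector (M : DecRep.{u} Λ)
    (hB : (LinearMap.ker ((quiverMatrix V).map (Int.cast : ℤ → ℚ)).mulVecLin : Set (V → ℚ)) ∩
      {a | ∀ i, 0 ≤ a i} = {0}) : M.ccFunction.coeff M.gVector = 1 := by
  rw [M.coeff_ccFunction, neg_add_cancel, finsum_eq_single _ 0]
  · rw [quiverMatrix_mulVec_zero, Finsupp.single_eq_same, M.rep.eulerPoincareChar_grassmannian_zero, mul_one,
      Int.cast_one]
  · intro e he
    rw [Finsupp.single_eq_of_ne, mul_zero]
    exact fun h => he (eq_zero_of_quiverMatrix_mulVec_eq_zero hB h.symm)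

theorem DecRep.sub_gVector_mem_quiverCone (M : DecRep.{u} Λ) (a : V → ℤ)
    (ha : M.ccFunction.coeff a ≠ 0) : a - M.gVector ∈ quiverCone V := by
  rw [M.coeff_ccFunction, Int.cast_ne_zero] at ha
  obtain ⟨e, he⟩ := not_forall.1 (mt finsum_eq_zero_of_forall_eq_zero ha)
  refine ⟨e, ?_⟩
  by_contra h
  refine right_ne_zero_of_mul he (Finsupp.single_eq_of_ne fun h' => h ?_)
  rw [sub_eq_neg_add]
  exact h'.symm

end BasicAlgebra

/-! ### Linear independence from pointed supports. -/

/-- Laurent polynomials whose supports are contained in translates `g j + S` of a pointed cone `S`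
by pairwise different vectors, with nonzero coefficient at the apex, are linearly independent. -/
theorem AddMonoidAlgebra.linearIndependent_of_pointed {K G J : Type*} [Field K] [AddCommGroup G]
    (S : AddSubmonoid G) (hS : ∀ a ∈ S, -a ∈ S → a = 0) (f : J → AddMonoidAlgebra K G) (g : J → G)
    (hg : Function.Injective g) (hapex : ∀ j, (f j).coeff (g j) ≠ 0)
    (hsupp : ∀ j a, (f j).coeff a ≠ 0 → a - g j ∈ S) : LinearIndependent K f := by
  classical
  rw [linearIndependent_iff']
  intro s c hc
  by_contra! hne
  obtain ⟨i, his, hi⟩ := hne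
  -- Here `j ≤ k` means that the apex `g k` lies in the translated cone `g j + S`. A preorder
  -- suffices for a minimal element of a finite nonempty set; antisymmetry is recovered at the end
  -- from `hS` and `hg`.
  let _ : Preorder J :=
    { le := fun j k => g k - g j ∈ S
      le_refl := fun j => by simp
      le_trans := fun j k l h1 h2 => by simpa using S.add_mem h2 h1 }
  obtain ⟨j, hj⟩ := (s.filter fun j => c j ≠ 0).exists_minimal
    ⟨i, Finset.mem_filter.2 ⟨his, hi⟩⟩
  obtain ⟨hjs, hcj⟩ := Finset.mem_filter.1 hj.1
  -- Compare coefficients at the minimal apex. Any other `k` contributing there satisfies `k ≤ j`,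
  -- so minimality gives `j ≤ k`, and pointedness forces `g k = g j`.
  have h := congrArg (fun x => x.coeff (g j)) hc
  simp only [AddMonoidAlgebra.coeff_sum, Finsupp.finsetSum_apply, AddMonoidAlgebra.coeff_smul,
    Finsupp.smul_apply, smul_eq_mul, AddMonoidAlgebra.coeff_zero, Finsupp.zero_apply] at h
  rw [Finset.sum_eq_single j _ (fun h => (h hjs).elim)] at h
  · exact mul_ne_zero hcj (hapex j) h
  · intro k hks hkj
    by_contra hk
    have hkj' : g j - g k ∈ S := hsupp k _ (right_ne_zero_of_mul hk)
    have hjk' : g k - g j ∈ S :=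
      hj.2 (Finset.mem_filter.2 ⟨hks, left_ne_zero_of_mul hk⟩) hkj'
    exact hkj (hg (sub_eq_zero.1 (hS _ hjk' (by rwa [neg_sub]))))

theorem proposition4p4 {V : Type} [Fintype V] [Quiver.{0} V] [∀ i j : V, Finite (i ⟶ j)]
    (Λ : BasicAlgebra V) {J : Type*} (M : J → BasicAlgebra.DecRep.{u} Λ)
    (hB : (LinearMap.ker ((quiverMatrix V).map (Int.cast : ℤ → ℚ)).mulVecLin : Set (V → ℚ)) ∩
      {a | ∀ i, 0 ≤ a i} = {0})
    (hg : ∀ j k, j ≠ k → (M j).gVector ≠ (M k).gVector) :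
    (∀ j k, j ≠ k → (M j).ccElement ≠ (M k).ccElement) ∧
      LinearIndependent ℂ fun j => (M j).ccElement := by
  -- Independence is checked in the ambient Laurent polynomial ring and pulled back along the
  -- inclusion of the subalgebra.
  have hli : LinearIndependent ℂ fun j => (M j).ccElement :=
    LinearIndependent.of_comp (BasicAlgebra.ccAlgebra.{u} Λ).val.toLinearMap
      (AddMonoidAlgebra.linearIndependent_of_pointed (quiverCone V) (quiverCone_pointed hB)
        (fun j => (M j).ccFunction) (fun j => (M j).gVector)
        (fun j k h => not_imp_not.1 (hg j k) h)
        (fun j => by rw [(M j).coeff_ccFunction_gVector hB]; exact one_ne_zero)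
        (fun j => (M j).sub_gVector_mem_quiverCone))
  -- A linearly independent family has no repeated members, so distinctness follows from
  -- independence.
  exact ⟨fun j k hjk h => hjk (hli.injective h), hli⟩
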